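/- Conventions. A Boolean function on a set $V$ of variables is identified with the set of its satisfying assignments, and $|F|$ is the number of satisfying assignments of $F$. For a graph $G$, $\varphi(G)$ is the CNF with variable set $V(G)$ and clauses $(u\vee v)$ for $\{u,v\}\in E(G)$. The primal graph of a CNF has the variables as vertices, two distinct variables being adjacent if they occur in a common clause; the primal treewidth is the treewidth of the primal graph. A nondeterministic read-once branching program (NROBP) on $V$ is a finite directed acyclic graph with exactly one source and exactly one sink (parallel edges allowed), some of whose edges are labelled with literals of $V$, such that each variable of $V$ occurs exactly once on each source-sink path. It represents the function whose satisfying assignments are those given by the literals on the source-sink paths. Its size is the number of its nodes. Let $\mathcal G_k$ be the class of graphs $T(H)$, where $T$ is a complete rooted ternary tree (of any height) and $H$ is a path with $2\lfloor k/4\rfloor$ vertices: $T(H)$ consists of disjoint copies $H^v$ of $H$ for $v\in V(T)$ and, for each edge $\{u,v\}$ of $T$ and each vertex $i$ of $H$, an edge between the copies of $i$ in $H^u$ and $H^v$. For $m\in\mathbb N$ let $\mathbf\Phi_{k}^{m}=\{\varphi(G) : G\in\mathcal G_k,\ |V(G)|\ge k^m\}$. Theorem. There are universal constants $c>0$ and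 $m,k_0\in\mathbb N$ such that for every integer $k\ge k_0$ the class $\mathbf\Phi_k=\mathbf\Phi_k^{m}$ has the following properties. It contains CNFs with arbitrarily many variables. Every $\varphi\in\mathbf\Phi_k$ has primal treewidth at most $k$. Moreover, if $\varphi\in\mathbf\Phi_k$ has $n$ variables and $F\subseteq\varphi$ is a nonempty Boolean function on the variables of $\varphi$ with $$\frac{|\varphi|}{|F|}\le 2^{\sqrt n},$$ then every NROBP representing $F$ has size at least $n^{k/c}$. -/

import Mathlib

namespace ReadOnceBound

/-! ### CNFs and Boolean functions -/

/-- A literal over the variable set `V`: `(x, true)` is `x` and `(x, false)` is `¬x`. -/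
abbrev Literal (V : Type*) := V × Bool

/-- A CNF over the variable set `V`: a set of clauses, a clause being a set of literals
(all sets are finite when `V` is). -/
abbrev CNF (V : Type*) := Set (Set (Literal V))

/-- A Boolean function on `V`, regarded as the set of its satisfying assignments. -/
abbrev BoolFun (V : Type*) := Set (V → Bool)

/-- The assignment `a` satisfies (contains) the literal `l`. -/
def Sat {V : Type*} (a : V → Bool) (l : Literal V) : Prop := a l.1 = l.2

/-- The set of satisfying assignments of a CNF. -/
def CNF.models {V : Type*} (φ : CNF V) : BoolFun V :=
  {a | ∀ C ∈ φ, ∃ l ∈ C, Sat a l}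

/-- The primal graph of a CNF: two distinct variables are adjacent if they occur in a common
clause. -/
def primalGraph {V : Type*} (φ : CNF V) : SimpleGraph V where
  Adj u v := u ≠ v ∧ ∃ C ∈ φ, (∃ b, (u, b) ∈ C) ∧ (∃ b, (v, b) ∈ C)
  symm := ⟨fun _ _ ⟨hne, C, hC, hu, hv⟩ => ⟨hne.symm, C, hC, hv, hu⟩⟩
  loopless := ⟨fun _ h => h.1 rfl⟩

/-- The monotone 2-CNF `φ(G)` with variables `V(G)` and clauses `(u ∨ v)`, `{u, v} ∈ E(G)`. -/
def cnfOfGraph {V : Type*} (G : SimpleGraph V) : CNF V :=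
  {C | ∃ u v, G.Adj u v ∧ C = {(u, true), (v, true)}}

/-! ### Treewidth -/

/-- A tree decomposition of `G`: a finite tree and a finite bag of vertices of `G` for each node
of the tree, such that each vertex and each edge is contained in some bag and, for each vertex,
the nodes whose bags contain it induce a connected subgraph of the tree. -/
structure TreeDecomposition {V : Type*} (G : SimpleGraph V) where
  Index : Type
  finite_index : Finite Index
  tree : SimpleGraph Index
  isTree : tree.IsTree
  bag : Index → Finset V
  vertex_mem : ∀ v, ∃ i, v ∈ bag i
  edge_mem : ∀ u v, G.Adj u v → ∃ i, u ∈ bag i ∧ v ∈ bag i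
  connected : ∀ v, (tree.induce {i | v ∈ bag i}).Preconnected

/-- The treewidth of `G`: the least `w` such that `G` has a tree decomposition all of whose bags
have at most `w + 1` elements. -/
noncomputable def treewidth {V : Type*} (G : SimpleGraph V) : ℕ∞ :=
  ⨅ w ∈ {w : ℕ | ∃ D : TreeDecomposition G, ∀ i, (D.bag i).card ≤ w + 1}, (w : ℕ∞)

/-! ### The graphs and the CNFs -/

/-- The vertices of the complete rooted ternary tree of height `h`: the words of length at most
`h` over a three-letter alphabet. The root is the empty word. -/
abbrev TernaryVertex (h : ℕ) : Type := {l : List (Fin 3) // l.length ≤ h}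

/-- The complete rooted ternary tree of height `h`: the children of the word `u` (of length less
than `h`) are its three extensions by one letter. -/
def ternaryTree (h : ℕ) : SimpleGraph (TernaryVertex h) :=
  SimpleGraph.fromRel fun u v => ∃ i : Fin 3, v.1 = u.1 ++ [i]

/-- The class of the graphs `T(H)`, where `T` is a complete rooted ternary tree and `H` is a path
with `2 ⌊k / 4⌋` vertices. The graph `T(H)` is the box product: it consists of a copy `H^v` of `H`
for each vertex `v` of `T`, and of the edges between the copies of `i ∈ V(H)` in `H^u` and in
`H^v` whenever `u` and `v` are adjacent in `T`. -/
def graphClass (k : ℕ) : Set (Σ V : Type, SimpleGraph V) :=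
  Set.range fun h : ℕ =>
    ⟨TernaryVertex h × Fin (2 * (k / 4)),
      (ternaryTree h).boxProd (SimpleGraph.pathGraph (2 * (k / 4)))⟩

/-- The class of the CNFs `φ(G)` for the graphs `G` of `graphClass k` with at least `k ^ m`
vertices. -/
def cnfClass (m k : ℕ) : Set (Σ V : Type, CNF V) :=
  {φ | ∃ G ∈ graphClass k, k ^ m ≤ Nat.card G.1 ∧ φ = ⟨G.1, cnfOfGraph G.2⟩}

/-! ### Nondeterministic read-once branching programs -/

/-- A finite directed acyclic graph with exactly one source and exactly one sink, each of whose
edges is unlabelled (`none`) or labelled with a literal of `V`. `Edge u l v` says that there is an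
edge from `u` to `v` with label `l`, so edges with different labels may be parallel. -/
structure LabelledDAG (V : Type*) where
  Node : Type
  finite_node : Finite Node
  Edge : Node → Option (Literal V) → Node → Prop
  acyclic : ∀ u, ¬ Relation.TransGen (fun a b => ∃ l, Edge a l b) u u
  source : Node
  sink : Node
  source_iff : ∀ u, (∀ w l, ¬ Edge w l u) ↔ u = source
  sink_iff : ∀ u, (∀ l w, ¬ Edge u l w) ↔ u = sink

/-- `Z.Path u v L`: there is a directed path of `Z` from `u` to `v` along which the literals
occurring as labels are, in this order, those of the list `L`. -/
inductive LabelledDAG.Path {V : Type*} (Z : LabelledDAG V) :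
    Z.Node → Z.Node → List (Literal V) → Prop
  | nil (u : Z.Node) : LabelledDAG.Path Z u u []
  | cons {u v w : Z.Node} {l : Option (Literal V)} {L : List (Literal V)} :
      Z.Edge u l v → LabelledDAG.Path Z v w L → LabelledDAG.Path Z u w (l.toList ++ L)

/-- A nondeterministic read-once branching program on `V`: each variable of `V` occurs exactly
once (at least once and without repetition) on each source-sink path. -/
structure NROBP (V : Type*) extends LabelledDAG V where
  occurs : ∀ L, toLabelledDAG.Path source sink L → ∀ x, x ∈ L.map Prod.fst
  nodup : ∀ L, toLabelledDAG.Path source sink L → (L.map Prod.fst).Nodup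

/-- The function implemented by a program: its satisfying assignments are those given by the
literals on the source-sink paths. -/
def NROBP.toFun {V : Type*} (Z : NROBP V) : BoolFun V :=
  {a | ∃ L, Z.toLabelledDAG.Path Z.source Z.sink L ∧ ∀ l ∈ L, Sat a l}

/-- The size of a program: its number of nodes. -/
noncomputable def NROBP.size {V : Type*} (Z : NROBP V) : ℕ := Nat.card Z.Node

end ReadOnceBound

namespace ReadOnceBound

/-! Let `p = k / 4`, let `t` be a multiple of `p` of order `k log n`, and let `Z` be a program for
`F`. Cut a source-sink path at a node `z`. Because `Z` is read-once, the prefix of one accepted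
assignment at `z` can be spliced with the suffix of another. Hence an edge of `G` between a variable
read before `z` and one read after it must have an end that is true in every assignment accepted via
`z` (`NROBP.forced_of_adj`). A crossing matching with `t` edges thus forces `t` distinct variables.
As degrees are at most 6, forcing `t` variables leaves at most a `(64/65)^t` fraction of the models
(`card_models_forced`).

One cut cannot offset the allowed loss `2^√n`, so about `√n` disjoint parts of the graph are used at
once: the subtrees rooted at depth `m ≈ h / 2`. Whatever the order of the variables, each subtree
has its own moment at which a matching of size `t` inside it is crossed
(`exists_initial_crossingMatching`). An accepted assignment therefore yields a tuple of `M = 3^m`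
nodes, and each tuple accounts for at most a `(64/65)^(M t)` fraction of the models. So `(65/64)^(M
t) ≤ size^M * 2^√n`; since `√n` is small against `M t`, taking `M`-th roots gives `size ≥ 2^(t/128)`
(`NROBP.ncard_toFun_le`, `two_rpow_le_of_counting`).

The matching grows by `p` with each level of the tree: among three children, the one with the median
moment keeps its matching, while the other two make the rest of the subtree balanced at that moment,
and this supplies `p` further edges (`exists_crossingMatching_boxProd`). -/

/-! ### Matchings crossing a cut -/

/-- `M` is a matching of `G` all of whose edges lie in `U` and lead from `S` to its complement. -/
structure IsCrossingMatching {V : Type*} (G : SimpleGraph V) (S U : Set V)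
    (M : Finset (V × V)) : Prop where
  adj : ∀ e ∈ M, G.Adj e.1 e.2
  fst_mem : ∀ e ∈ M, e.1 ∈ S ∧ e.1 ∈ U
  snd_mem : ∀ e ∈ M, e.2 ∉ S ∧ e.2 ∈ U
  fst_inj : Set.InjOn Prod.fst (M : Set (V × V))
  snd_inj : Set.InjOn Prod.snd (M : Set (V × V))

namespace IsCrossingMatching

variable {V : Type*} {G : SimpleGraph V} {S U U' : Set V} {M M' : Finset (V × V)}

theorem mono (h : IsCrossingMatching G S U M) (hU : U ⊆ U') : IsCrossingMatching G S U' M :=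
  ⟨h.adj, fun e he => ⟨(h.fst_mem e he).1, hU (h.fst_mem e he).2⟩,
    fun e he => ⟨(h.snd_mem e he).1, hU (h.snd_mem e he).2⟩, h.fst_inj, h.snd_inj⟩

theorem disjoint (h : IsCrossingMatching G S U M) (h' : IsCrossingMatching G S U' M')
    (hU : Disjoint U U') : Disjoint M M' := by
  rw [Finset.disjoint_left]
  intro e he he'
  exact Set.disjoint_left.1 hU (h.fst_mem e he).2 (h'.fst_mem e he').2

theorem union [DecidableEq V] (h : IsCrossingMatching G S U M)
    (h' : IsCrossingMatching G S U' M') (hU : Disjoint U U') :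
    IsCrossingMatching G S (U ∪ U') (M ∪ M') := by
  rw [Set.disjoint_left] at hU
  refine ⟨?_, ?_, ?_, ?_, ?_⟩
  · intro e he
    rcases Finset.mem_union.1 he with he | he
    exacts [h.adj e he, h'.adj e he]
  · intro e he
    rcases Finset.mem_union.1 he with he | he
    exacts [⟨(h.fst_mem e he).1, Or.inl (h.fst_mem e he).2⟩,
      ⟨(h'.fst_mem e he).1, Or.inr (h'.fst_mem e he).2⟩]
  · intro e he
    rcases Finset.mem_union.1 he with he | he
    exacts [⟨(h.snd_mem e he).1, Or.inl (h.snd_mem e he).2⟩,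
      ⟨(h'.snd_mem e he).1, Or.inr (h'.snd_mem e he).2⟩]
  · intro e he f hf hef
    rcases Finset.mem_union.1 he with he | he <;> rcases Finset.mem_union.1 hf with hf | hf
    · exact h.fst_inj he hf hef
    · exact absurd (hef ▸ (h'.fst_mem f hf).2) (hU (h.fst_mem e he).2)
    · exact absurd (hef ▸ (h'.fst_mem e he).2) (hU (h.fst_mem f hf).2)
    · exact h'.fst_inj he hf hef
  · intro e he f hf hef
    rcases Finset.mem_union.1 he with he | he <;> rcases Finset.mem_union.1 hf with hf | hf
    · exact h.snd_inj he hf hef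
    · exact absurd (hef ▸ (h'.snd_mem f hf).2) (hU (h.snd_mem e he).2)
    · exact absurd (hef ▸ (h'.snd_mem e he).2) (hU (h.snd_mem f hf).2)
    · exact h'.snd_inj he hf hef

/-- Crossing edges in different fibres of a map form a crossing matching. -/
theorem of_fibres {ι : Type*} (g : V → ι) (I : Finset ι)
    (h : ∀ i ∈ I, ∃ x y, G.Adj x y ∧ (x ∈ S ∧ x ∈ U) ∧ (y ∉ S ∧ y ∈ U) ∧ g x = i ∧ g y = i) :
    ∃ M, IsCrossingMatching G S U M ∧ M.card = I.card := by
  classical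
  rcases I.eq_empty_or_nonempty with rfl | ⟨i₀, hi₀⟩
  · exact ⟨∅, ⟨by simp, by simp, by simp, by simp, by simp⟩, rfl⟩
  have : Nonempty V := ⟨(h i₀ hi₀).choose⟩
  choose! x y hadj hx hy hgx hgy using h
  refine ⟨I.image fun i => (x i, y i), ⟨?_, ?_, ?_, ?_, ?_⟩, Finset.card_image_of_injOn ?_⟩
  · simpa using hadj
  · simpa using hx
  · simpa using hy
  · intro e he f hf hef
    simp only [Finset.coe_image, Set.mem_image] at he hf
    obtain ⟨i, hi, rfl⟩ := he
    obtain ⟨j, hj, rfl⟩ := hf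
    have : i = j := by rw [← hgx i hi, ← hgx j hj]; exact congrArg g hef
    rw [this]
  · intro e he f hf hef
    simp only [Finset.coe_image, Set.mem_image] at he hf
    obtain ⟨i, hi, rfl⟩ := he
    obtain ⟨j, hj, rfl⟩ := hf
    have : i = j := by rw [← hgy i hi, ← hgy j hj]; exact congrArg g hef
    rw [this]
  · intro i hi j hj hij
    rw [← hgx i hi, ← hgx j hj]
    exact congrArg (fun e => g e.1) hij

end IsCrossingMatching

/-- In a preconnected graph, each nontrivial cut is crossed by an edge. -/
theorem exists_adj_of_preconnected {V : Type*} {G : SimpleGraph V} (hG : G.Preconnected)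
    {S : Set V} {a b : V} (ha : a ∈ S) (hb : b ∉ S) : ∃ x y, G.Adj x y ∧ x ∈ S ∧ y ∉ S := by
  obtain ⟨p⟩ := hG a b
  obtain ⟨d, -, h1, h2⟩ := p.exists_boundary_dart S ha hb
  exact ⟨d.fst, d.snd, d.adj, h1, h2⟩

/-- If both classes of a bipartition of a box product of connected graphs with at least `p` vertices
have at least `p ^ 2` elements, then the bipartition is crossed by a matching of size `p`. -/
theorem exists_crossingMatching_boxProd {α β : Type*} [Fintype α] [Fintype β]
    {A : SimpleGraph α} {B : SimpleGraph β} {W : Set α} (hA : (A.induce W).Preconnected)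
    (hB : B.Preconnected) {p : ℕ} (hp : 0 < p) (hW : p ≤ W.ncard) (hβ : p ≤ Fintype.card β)
    {S : Set (α × β)} (hin : p ^ 2 ≤ (W ×ˢ Set.univ ∩ S).ncard)
    (hout : p ^ 2 ≤ (W ×ˢ Set.univ \ S).ncard) :
    ∃ M, IsCrossingMatching (A.boxProd B) S (W ×ˢ Set.univ) M ∧ p ≤ M.card := by
  classical
  let R : Finset α := {a | a ∈ W ∧ (∃ b, (a, b) ∈ S) ∧ ∃ b, (a, b) ∉ S}
  let C : Finset β := {b | (∃ a ∈ W, (a, b) ∈ S) ∧ ∃ a ∈ W, (a, b) ∉ S}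
  by_cases hR : p ≤ R.card
  · obtain ⟨M, hM, hc⟩ := IsCrossingMatching.of_fibres (G := A.boxProd B) (S := S)
      (U := W ×ˢ Set.univ) Prod.fst R (by
        intro a ha
        simp only [R, Finset.mem_filter, Finset.mem_univ, true_and] at ha
        obtain ⟨haW, ⟨b, hb⟩, ⟨b', hb'⟩⟩ := ha
        obtain ⟨x, y, hxy, hx, hy⟩ := exists_adj_of_preconnected hB (S := {b | (a, b) ∈ S}) hb hb'
        exact ⟨(a, x), (a, y), by simp [SimpleGraph.boxProd_adj, hxy], ⟨hx, by simp [haW]⟩,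
          ⟨hy, by simp [haW]⟩, rfl, rfl⟩)
    exact ⟨M, hM, hc ▸ hR⟩
  by_cases hC : p ≤ C.card
  · obtain ⟨M, hM, hc⟩ := IsCrossingMatching.of_fibres (G := A.boxProd B) (S := S)
      (U := W ×ˢ Set.univ) Prod.snd C (by
        intro b hb
        simp only [C, Finset.mem_filter, Finset.mem_univ, true_and] at hb
        obtain ⟨⟨a, haW, ha⟩, ⟨a', haW', ha'⟩⟩ := hb
        obtain ⟨x, y, hxy, hx, hy⟩ := exists_adj_of_preconnected hA
          (S := {a : W | (a.1, b) ∈ S}) (a := ⟨a, haW⟩) (b := ⟨a', haW'⟩) ha ha'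
        exact ⟨(x, b), (y, b), by simpa [SimpleGraph.boxProd_adj] using hxy, ⟨hx, by simp⟩,
          ⟨hy, by simp⟩, rfl, rfl⟩)
    exact ⟨M, hM, hc ▸ hC⟩
  -- Now some row and some column are each contained in one class. They meet, so it is the same
  -- class; every element of the other class then lies in a mixed row and a mixed column, leaving
  -- room for fewer than `p ^ 2` of them.
  exfalso
  push Not at hR hC
  obtain ⟨a₀, ha₀, haR⟩ : ∃ a ∈ W, a ∉ R := by
    by_contra! hcon
    have := Set.ncard_le_ncard (s := W) (t := (R : Set α)) hcon
    rw [Set.ncard_coe_finset] at this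
    omega
  obtain ⟨b₀, hbC⟩ : ∃ b, b ∉ C := by
    by_contra! hcon
    rw [Finset.eq_univ_iff_forall.2 hcon, Finset.card_univ] at hC
    omega
  have hcard : ∀ X : Set (α × β), X ⊆ (R ×ˢ C : Finset (α × β)) → X.ncard < p ^ 2 := by
    intro X hX
    have := Set.ncard_le_ncard hX
    rw [Set.ncard_coe_finset, Finset.card_product] at this
    nlinarith
  simp only [R, Finset.mem_filter, Finset.mem_univ, true_and, not_and, not_exists, not_not,
    forall_exists_index] at haR
  simp only [C, Finset.mem_filter, Finset.mem_univ, true_and, not_and, not_exists, not_not,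
    forall_exists_index] at hbC
  by_cases h₀ : (a₀, b₀) ∈ S
  · have hrow := haR ha₀ b₀ h₀
    have hcol := hbC a₀ ⟨ha₀, h₀⟩
    refine absurd hout (not_le.2 (hcard _ ?_))
    rintro ⟨a, b⟩ ⟨⟨haW, -⟩, hS⟩
    simp only [Finset.coe_product, Set.mem_prod, Finset.mem_coe, R, C, Finset.mem_filter,
      Finset.mem_univ, true_and]
    exact ⟨⟨haW, ⟨b₀, hcol a haW⟩, b, hS⟩, ⟨a₀, ha₀, hrow b⟩, a, haW, hS⟩
  · have hrow : ∀ b, (a₀, b) ∉ S := fun b hb => h₀ (haR ha₀ b hb b₀)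
    have hcol : ∀ a ∈ W, (a, b₀) ∉ S := fun a ha hb => h₀ (hbC a ⟨ha, hb⟩ a₀ ha₀)
    refine absurd hin (not_le.2 (hcard _ ?_))
    rintro ⟨a, b⟩ ⟨⟨haW, -⟩, hS⟩
    simp only [Finset.coe_product, Set.mem_prod, Finset.mem_coe, R, C, Finset.mem_filter,
      Finset.mem_univ, true_and]
    exact ⟨⟨haW, ⟨b, hS⟩, b₀, hcol a haW⟩, ⟨a, haW, hS⟩, a₀, ha₀, hrow b⟩

/-! ### Counting models with forced variables -/

theorem mem_models_cnfOfGraph {V : Type*} {G : SimpleGraph V} {a : V → Bool} :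
    a ∈ (cnfOfGraph G).models ↔ ∀ u v, G.Adj u v → a u = true ∨ a v = true := by
  constructor
  · intro h u v huv
    obtain ⟨l, hl, hs⟩ := h _ ⟨u, v, huv, rfl⟩
    rcases hl with rfl | rfl
    exacts [Or.inl hs, Or.inr hs]
  · rintro h C ⟨u, v, huv, rfl⟩
    rcases h u v huv with h | h
    exacts [⟨(u, true), by simp, h⟩, ⟨(v, true), by simp, h⟩]

/-- In a graph of maximal degree at most `d`, each further variable that is forced to be true
reduces the number of models by a constant factor. -/
theorem card_models_forced {V : Type*} [Finite V] (G : SimpleGraph V) (d : ℕ)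
    (hd : ∀ v, (G.neighborSet v).ncard ≤ d) (D : Finset V) :
    (2 ^ d + 1) ^ D.card * {a ∈ (cnfOfGraph G).models | ∀ x ∈ D, a x = true}.ncard ≤
      (2 ^ d) ^ D.card * (cnfOfGraph G).models.ncard := by
  classical
  induction D using Finset.induction_on with
  | empty => simp
  | insert x D hx ih =>
    set P := {a ∈ (cnfOfGraph G).models | ∀ x ∈ D, a x = true} with hP
    set P₁ := {a ∈ (cnfOfGraph G).models | ∀ y ∈ insert x D, a y = true} with hP₁
    let P₀ := {a ∈ P | a x = false}
    have hsplit : P₁.ncard + P₀.ncard = P.ncard := by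
      rw [← Set.ncard_union_eq]
      · congr 1
        ext a
        simp only [hP₁, P₀, hP, Set.mem_union, Set.mem_ofPred_eq, Finset.forall_mem_insert]
        cases a x <;> simp
      · rw [Set.disjoint_left]
        rintro a ⟨-, h1⟩ ⟨-, h2⟩
        simp [h1 x (by simp)] at h2
    -- Switching `x` to false stays within the models once all neighbours of `x` are made true. The
    -- second component records their old values, so at most `2 ^ d` assignments share an image.
    let f : (V → Bool) → (V → Bool) × (G.neighborSet x → Bool) := fun a =>
      (fun y => if y = x then false else if G.Adj x y then true else a y, fun y => a y)
    have hf : ∀ a ∈ P₁, f a ∈ P₀ ×ˢ (Set.univ : Set (G.neighborSet x → Bool)) := by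
      rintro a ⟨ha, hD⟩
      rw [mem_models_cnfOfGraph] at ha
      refine ⟨⟨⟨mem_models_cnfOfGraph.2 ?_, ?_⟩, by simp [f]⟩, trivial⟩
      · intro u v huv
        by_cases hu : u = x
        · subst hu
          right
          simp [f, huv, huv.ne']
        by_cases hv : v = x
        · subst hv
          left
          simp [f, huv.symm, huv.ne]
        simp only [f, hu, hv, if_false]
        rcases ha u v huv with h | h
        · left; split_ifs <;> simp [h]
        · right; split_ifs <;> simp [h]
      · intro y hy
        have hyx : y ≠ x := fun h => hx (h ▸ hy)
        simp only [f, hyx, if_false]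
        split_ifs
        · rfl
        · exact hD y (by simp [hy])
    have hinj : Set.InjOn f P₁ := by
      intro a ha b hb hab
      funext y
      by_cases hy : y = x
      · rw [hy, ha.2 x (by simp), hb.2 x (by simp)]
      by_cases hxy : G.Adj x y
      · exact congrFun (congrArg Prod.snd hab) ⟨y, hxy⟩
      · have := congrFun (congrArg Prod.fst hab) y
        simpa [f, hy, hxy] using this
    have hle : P₁.ncard ≤ P₀.ncard * 2 ^ d := by
      calc P₁.ncard ≤ (P₀ ×ˢ (Set.univ : Set (G.neighborSet x → Bool))).ncard :=
            Set.ncard_le_ncard_of_injOn f hf hinj (Set.toFinite _)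
        _ = P₀.ncard * 2 ^ (G.neighborSet x).ncard := by
            rw [Set.ncard_prod, Set.ncard_univ, Nat.card_fun]
            simp [Nat.card_coe_set_eq]
        _ ≤ P₀.ncard * 2 ^ d := by
            gcongr
            · norm_num
            · exact hd x
    rw [Finset.card_insert_of_notMem hx]
    calc (2 ^ d + 1) ^ (D.card + 1) * P₁.ncard
        = (2 ^ d + 1) ^ D.card * (2 ^ d * P₁.ncard + P₁.ncard) := by ring
      _ ≤ (2 ^ d + 1) ^ D.card * (2 ^ d * P₁.ncard + P₀.ncard * 2 ^ d) := by gcongr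
      _ = 2 ^ d * ((2 ^ d + 1) ^ D.card * P.ncard) := by rw [← hsplit]; ring
      _ ≤ 2 ^ d * ((2 ^ d) ^ D.card * (cnfOfGraph G).models.ncard) := by gcongr
      _ = _ := by ring

/-! ### The ternary tree -/

instance finite_ternaryVertex (h : ℕ) : Finite (TernaryVertex h) :=
  (List.finite_length_le (Fin 3) h).to_subtype

noncomputable instance fintype_ternaryVertex (h : ℕ) : Fintype (TernaryVertex h) :=
  Fintype.ofFinite _

theorem ternaryTree_adj {h : ℕ} {u v : TernaryVertex h} :
    (ternaryTree h).Adj u v ↔ (∃ i, v.1 = u.1 ++ [i]) ∨ ∃ i, u.1 = v.1 ++ [i] := by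
  rw [ternaryTree, SimpleGraph.fromRel_adj]
  refine ⟨fun h => h.2, fun h => ⟨?_, h⟩⟩
  rintro rfl
  rcases h with ⟨i, hi⟩ | ⟨i, hi⟩ <;> simpa using congrArg List.length hi

/-- A set of nodes that contains the parent of each of its elements other than `w` is connected. -/
theorem ternaryTree_induce_preconnected {h : ℕ} {W : Set (TernaryVertex h)} (w : TernaryVertex h)
    (hw : w ∈ W) (hW : ∀ v ∈ W, v ≠ w → ∃ u ∈ W, ∃ i, v.1 = u.1 ++ [i]) :
    ((ternaryTree h).induce W).Preconnected := by
  have key : ∀ (n : ℕ) (v : W), v.1.1.length = n →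
      ((ternaryTree h).induce W).Reachable v ⟨w, hw⟩ := by
    intro n
    induction n with
    | zero =>
      intro v hv
      by_cases hvw : v.1 = w
      · obtain rfl : v = ⟨w, hw⟩ := Subtype.ext hvw
        exact SimpleGraph.Reachable.refl _
      · obtain ⟨u, -, i, hi⟩ := hW v.1 v.2 hvw
        simp [hi] at hv
    | succ n ih =>
      intro v hv
      by_cases hvw : v.1 = w
      · obtain rfl : v = ⟨w, hw⟩ := Subtype.ext hvw
        exact SimpleGraph.Reachable.refl _
      · obtain ⟨u, hu, i, hi⟩ := hW v.1 v.2 hvw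
        refine SimpleGraph.Reachable.trans (SimpleGraph.Adj.reachable (v := ⟨u, hu⟩) ?_)
          (ih ⟨u, hu⟩ (by simpa [hi] using hv))
        simpa [ternaryTree_adj] using Or.inr ⟨i, hi⟩
  intro u v
  exact (key _ u rfl).trans (key _ v rfl).symm

theorem exists_parent {h : ℕ} (v : TernaryVertex h) (hv : v.1 ≠ []) :
    ∃ u : TernaryVertex h, ∃ i, v.1 = u.1 ++ [i] :=
  ⟨⟨v.1.dropLast, by have := v.2; rw [List.length_dropLast]; omega⟩, v.1.getLast hv,
    (List.dropLast_append_getLast hv).symm⟩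

/-- Sending a non-root node to the edge to its parent is a bijection onto the edges, so a connected
graph has one edge fewer than vertices. -/
theorem ternaryTree_isTree (h : ℕ) : (ternaryTree h).IsTree := by
  rw [SimpleGraph.isTree_iff_connected_and_card]
  constructor
  · have hpre : (ternaryTree h).Preconnected := by
      have := ternaryTree_induce_preconnected (W := Set.univ) (⟨[], by simp⟩ : TernaryVertex h)
        trivial (fun v _ hv => by
          obtain ⟨u, hu⟩ := exists_parent v (fun h => hv (Subtype.ext h))
          exact ⟨u, trivial, hu⟩)
      exact (SimpleGraph.induceUnivIso _).preconnected_iff.1 this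
    have : Nonempty (TernaryVertex h) := ⟨⟨[], by simp⟩⟩
    exact ⟨hpre⟩
  · choose! par lab hpar using fun v : TernaryVertex h => exists_parent v
    have hb : Set.BijOn (fun v => s(par v, v)) {v : TernaryVertex h | v.1 ≠ []}
        (ternaryTree h).edgeSet := by
      refine ⟨?_, ?_, ?_⟩
      · intro v hv
        exact ternaryTree_adj.2 (Or.inl ⟨_, hpar v hv⟩)
      · intro v hv w hw hvw
        rcases Sym2.eq_iff.1 hvw with ⟨-, h2⟩ | ⟨h1, h2⟩
        · exact h2
        · have e1 := congrArg List.length (hpar v hv)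
          have e2 := congrArg List.length (hpar w hw)
          rw [h1] at e1
          rw [← h2] at e2
          simp at e1 e2
          omega
      · have key : ∀ u v : TernaryVertex h, (∃ i, v.1 = u.1 ++ [i]) →
            s(u, v) ∈ (fun v => s(par v, v)) '' {v : TernaryVertex h | v.1 ≠ []} := by
          rintro u v ⟨i, hi⟩
          have hv : v.1 ≠ [] := by simp [hi]
          refine ⟨v, hv, ?_⟩
          have : par v = u := by
            apply Subtype.ext
            have := (hpar v hv).symm.trans hi
            exact (List.append_inj' this rfl).1
          simp [this]
        intro e
        induction e with
        | _ u v =>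
          intro he
          rcases ternaryTree_adj.1 he with h1 | h1
          · exact key u v h1
          · rw [Sym2.eq_swap]
            exact key v u h1
    have h1 := hb.injOn.ncard_image
    rw [hb.image_eq] at h1
    rw [Nat.card_coe_set_eq, h1]
    have h2 : {v : TernaryVertex h | v.1 ≠ []} = {⟨[], by simp⟩}ᶜ := by
      ext v
      simp [Subtype.ext_iff]
    rw [h2, ← Set.ncard_add_ncard_compl {(⟨[], by simp⟩ : TernaryVertex h)}, Set.ncard_singleton,
      add_comm]

/-- The factor 2 absorbs that of the path length `2 * p`, giving `n ≤ p * 3 ^ (h + 1)`. -/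
theorem card_ternaryVertex_le (h : ℕ) : 2 * Nat.card (TernaryVertex h) ≤ 3 ^ (h + 1) := by
  have h1 : Nat.card (TernaryVertex h) ≤ Nat.card (Σ l : Fin (h + 1), Fin l.1 → Fin 3) := by
    refine Nat.card_le_card_of_injective
      (fun v : TernaryVertex h => (⟨⟨v.1.length, Nat.lt_succ_of_le v.2⟩, v.1.get⟩ :
        Σ l : Fin (h + 1), Fin l.1 → Fin 3)) ?_
    intro u v huv
    have := congrArg (fun x : Σ l : Fin (h + 1), Fin l.1 → Fin 3 => List.ofFn x.2) huv
    simp only [List.ofFn_get] at this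
    exact Subtype.ext this
  have h2 : Nat.card (Σ l : Fin (h + 1), Fin l.1 → Fin 3) = ∑ l ∈ Finset.range (h + 1), 3 ^ l := by
    rw [Nat.card_eq_fintype_card, Fintype.card_sigma, Finset.sum_range]
    simp
  have h3 : ∀ n, 2 * ∑ l ∈ Finset.range n, 3 ^ l ≤ 3 ^ n := by
    intro n
    induction n with
    | zero => simp
    | succ n ih => rw [Finset.sum_range_succ, pow_succ]; omega
  have := h3 (h + 1)
  omega

/-- The nodes of the subtree rooted at the word `w`. -/
def subtree (h : ℕ) (w : List (Fin 3)) : Set (TernaryVertex h) := {v | w <+: v.1}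

theorem pow_le_ncard_subtree {h r : ℕ} {w : List (Fin 3)} (hw : w.length + r ≤ h) :
    3 ^ r ≤ (subtree h w).ncard := by
  have : (Set.univ : Set (Fin r → Fin 3)).ncard ≤ (subtree h w).ncard := by
    refine Set.ncard_le_ncard_of_injOn (fun f => ⟨w ++ List.ofFn f, by simpa using hw⟩) ?_ ?_
      (Set.toFinite _)
    · intro f _
      exact List.prefix_append _ _
    · intro f _ g _ hfg
      exact List.ofFn_injective (List.append_cancel_left (Subtype.ext_iff.1 hfg))
  simpa [Set.ncard_univ] using this

theorem subtree_mono {h : ℕ} {w w' : List (Fin 3)} (hw : w <+: w') :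
    subtree h w' ⊆ subtree h w := fun _ hv => hw.trans hv

theorem disjoint_subtree {h : ℕ} {w w' : List (Fin 3)} (hl : w.length = w'.length) (hne : w ≠ w') :
    Disjoint (subtree h w) (subtree h w') := by
  rw [Set.disjoint_left]
  intro v hv hv'
  exact hne ((List.prefix_of_prefix_length_le hv hv' hl.le).eq_of_length hl)

theorem subtree_preconnected {h : ℕ} {w : List (Fin 3)} (hw : w.length ≤ h) :
    ((ternaryTree h).induce (subtree h w)).Preconnected := by
  refine ternaryTree_induce_preconnected ⟨w, hw⟩ (List.prefix_refl w) ?_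
  rintro v hv hne
  have hne' : v.1 ≠ w := fun h => hne (Subtype.ext h)
  obtain ⟨u, i, hi⟩ := exists_parent v (by
    rintro h0
    have : w <+: v.1 := hv
    rw [h0, List.prefix_nil] at this
    exact hne' (h0.trans this.symm))
  refine ⟨u, ?_, i, hi⟩
  have : w <+: u.1 ++ [i] := hi ▸ hv
  rcases List.prefix_concat_iff.1 this with h1 | h1
  · exact absurd (hi.trans h1.symm) hne'
  · exact h1

/-- The remainder still contains `w` and is closed under parents up to `w`. It hosts the additional
matching edges when the child `b` is the median one. -/
theorem subtree_diff_preconnected {h : ℕ} {w : List (Fin 3)} (hw : w.length ≤ h) (b : Fin 3) :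
    ((ternaryTree h).induce (subtree h w \ subtree h (w ++ [b]))).Preconnected := by
  refine ternaryTree_induce_preconnected ⟨w, hw⟩ ⟨List.prefix_refl w, fun hcon => ?_⟩ ?_
  · simpa using List.IsPrefix.length_le hcon
  rintro v ⟨hv, hvb⟩ hne
  have hne' : v.1 ≠ w := fun h => hne (Subtype.ext h)
  obtain ⟨u, i, hi⟩ := exists_parent v (by
    rintro h0
    have : w <+: v.1 := hv
    rw [h0, List.prefix_nil] at this
    exact hne' (h0.trans this.symm))
  refine ⟨u, ⟨?_, fun hu => hvb ?_⟩, i, hi⟩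
  · have : w <+: u.1 ++ [i] := hi ▸ hv
    rcases List.prefix_concat_iff.1 this with h1 | h1
    · exact absurd (hi.trans h1.symm) hne'
    · exact h1
  · show w ++ [b] <+: v.1
    rw [hi]
    exact List.IsPrefix.trans hu (List.prefix_append _ _)

/-! ### Large crossing matchings for initial segments of an ordering -/

/-- Discrete intermediate values: by injectivity, raising the threshold by one adds at most one
element. -/
theorem exists_ncard_inter_initial_eq {V : Type*} [Finite V] {ρ : V → ℕ}
    (hρ : Function.Injective ρ) (U : Set V) {m : ℕ} (hm : m ≤ U.ncard) :
    ∃ j, (U ∩ {x | ρ x < j}).ncard = m := by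
  have key : ∀ j m, m ≤ (U ∩ {x | ρ x < j}).ncard → ∃ i, (U ∩ {x | ρ x < i}).ncard = m := by
    intro j
    induction j with
    | zero =>
      intro m hm
      exact ⟨0, by simp at hm ⊢; omega⟩
    | succ j ih =>
      intro m hm
      by_cases h : m ≤ (U ∩ {x | ρ x < j}).ncard
      · exact ih m h
      · refine ⟨j + 1, ?_⟩
        have h1 : (U ∩ {x | ρ x < j + 1}) ⊆ (U ∩ {x | ρ x < j}) ∪ {x | ρ x = j} := by
          rintro x ⟨hx, hx'⟩
          rcases Nat.lt_succ_iff_lt_or_eq.1 hx' with h2 | h2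
          exacts [Or.inl ⟨hx, h2⟩, Or.inr h2]
        have h2 := (Set.ncard_le_ncard h1).trans (Set.ncard_union_le _ _)
        have h3 : ({x | ρ x = j} : Set V).ncard ≤ 1 :=
          (Set.ncard_le_one (Set.toFinite _)).2 fun x hx y hy => hρ (hx.trans hy.symm)
        omega
  obtain ⟨B, hB⟩ := (Set.finite_range ρ).bddAbove
  refine key (B + 1) m ?_
  have : U ∩ {x | ρ x < B + 1} = U :=
    Set.inter_eq_left.2 fun x _ => Nat.lt_succ_of_le (hB (Set.mem_range_self x))
  rwa [this]

/-- Each ordering of the vertices of `T(P)`, where `P` is a path with `2 * p` vertices, has an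
initial segment whose boundary contains a large matching inside a given subtree of `T`. -/
theorem exists_initial_crossingMatching {h p h₀ : ℕ} (hp : 0 < p) (hph : p ≤ 3 ^ h₀)
    {ρ : TernaryVertex h × Fin (2 * p) → ℕ} (hρ : Function.Injective ρ) (s : ℕ) :
    ∀ w : List (Fin 3), w.length + (h₀ + s) = h →
      ∃ j M, IsCrossingMatching ((ternaryTree h).boxProd (SimpleGraph.pathGraph (2 * p)))
          {x | ρ x < j} (subtree h w ×ˢ Set.univ) M ∧ p * (s + 1) ≤ M.card ∧
        p ^ 2 ≤ (subtree h w ×ˢ Set.univ ∩ {x | ρ x < j}).ncard ∧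
        p ^ 2 ≤ (subtree h w ×ˢ Set.univ \ {x | ρ x < j}).ncard := by
  classical
  induction s with
  | zero =>
    intro w hw
    have hcard : p ≤ (subtree h w).ncard := hph.trans (pow_le_ncard_subtree (by omega))
    -- This is where the path needs `2 * p` vertices: with at least `p` tree nodes, both sides of
    -- the cut can have `p ^ 2` elements.
    have hU : p ^ 2 + p ^ 2 ≤ (subtree h w ×ˢ (Set.univ : Set (Fin (2 * p)))).ncard := by
      rw [Set.ncard_prod, Set.ncard_univ, Nat.card_fin]
      nlinarith
    obtain ⟨j, hj⟩ := exists_ncard_inter_initial_eq hρ _ ((Nat.le_add_right _ _).trans hU)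
    have hout : p ^ 2 ≤
        (subtree h w ×ˢ (Set.univ : Set (Fin (2 * p))) \ {x | ρ x < j}).ncard := by
      have := Set.ncard_inter_add_ncard_sdiff_eq_ncard
        (subtree h w ×ˢ (Set.univ : Set (Fin (2 * p)))) {x | ρ x < j}
      omega
    obtain ⟨M, hM, hMc⟩ := exists_crossingMatching_boxProd (subtree_preconnected (by omega))
      (SimpleGraph.pathGraph_preconnected (2 * p)) hp hcard (by simp; omega) hj.ge hout
    exact ⟨j, M, hM, by simpa using hMc, hj.ge, hout⟩
  | succ s ih =>
    intro w hw
    choose j M hM hMc hin hout using fun b : Fin 3 => ih (w ++ [b]) (by simp; omega)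
    -- `b` is a child with median threshold.
    obtain ⟨a, b, c, hab, hcb, hjab, hjbc⟩ :
        ∃ a b c : Fin 3, a ≠ b ∧ c ≠ b ∧ j a ≤ j b ∧ j b ≤ j c := by
      rcases le_total (j 0) (j 1) with h1 | h1 <;> rcases le_total (j 1) (j 2) with h2 | h2 <;>
        rcases le_total (j 0) (j 2) with h3 | h3
      · exact ⟨0, 1, 2, by decide, by decide, h1, h2⟩
      · exact ⟨0, 1, 2, by decide, by decide, h1, h2⟩
      · exact ⟨0, 2, 1, by decide, by decide, h3, h2⟩
      · exact ⟨2, 0, 1, by decide, by decide, h3, h1⟩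
      · exact ⟨1, 0, 2, by decide, by decide, h1, h3⟩
      · exact ⟨1, 2, 0, by decide, by decide, h2, h3⟩
      · exact ⟨2, 1, 0, by decide, by decide, h2, h1⟩
      · exact ⟨2, 1, 0, by decide, by decide, h2, h1⟩
    have hsub : ∀ b : Fin 3, subtree h (w ++ [b]) ⊆ subtree h w :=
      fun b => subtree_mono (List.prefix_append _ _)
    have hsub' : ∀ e : Fin 3, e ≠ b →
        subtree h (w ++ [e]) ⊆ subtree h w \ subtree h (w ++ [b]) := by
      intro e he v hv
      refine ⟨hsub e hv, fun hv' => ?_⟩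
      exact Set.disjoint_left.1 (disjoint_subtree (by simp) (by simpa using he)) hv hv'
    have hcard : p ≤ (subtree h w \ subtree h (w ++ [b])).ncard :=
      (hph.trans (pow_le_ncard_subtree (by simp; omega))).trans
        (Set.ncard_le_ncard (hsub' a hab))
    -- The balance bounds are carried through the induction for this: at time `j b`, child `a` still
    -- has `p ^ 2` vertices inside the segment and child `c` has `p ^ 2` outside.
    have hin' : p ^ 2 ≤ ((subtree h w \ subtree h (w ++ [b])) ×ˢ
        (Set.univ : Set (Fin (2 * p))) ∩ {x | ρ x < j b}).ncard :=
      (hin a).trans (Set.ncard_le_ncard (Set.inter_subset_inter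
        (Set.prod_mono (hsub' a hab) subset_rfl) fun x hx => lt_of_lt_of_le hx hjab))
    have hout' : p ^ 2 ≤ ((subtree h w \ subtree h (w ++ [b])) ×ˢ
        (Set.univ : Set (Fin (2 * p))) \ {x | ρ x < j b}).ncard :=
      (hout c).trans (Set.ncard_le_ncard (Set.sdiff_subset_sdiff
        (Set.prod_mono (hsub' c hcb) subset_rfl) fun x hx => lt_of_lt_of_le hx hjbc))
    obtain ⟨N, hN, hNc⟩ := exists_crossingMatching_boxProd (subtree_diff_preconnected (by omega) b)
      (SimpleGraph.pathGraph_preconnected (2 * p)) hp hcard (by simp; omega) hin' hout'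
    have hdisj : Disjoint (subtree h (w ++ [b]) ×ˢ (Set.univ : Set (Fin (2 * p))))
        ((subtree h w \ subtree h (w ++ [b])) ×ˢ Set.univ) :=
      Set.disjoint_left.2 fun x hx hx' => hx'.1.2 hx.1
    refine ⟨j b, M b ∪ N, ((hM b).union hN hdisj).mono ?_, ?_, ?_, ?_⟩
    · exact Set.union_subset (Set.prod_mono (hsub b) subset_rfl)
        (Set.prod_mono Set.sdiff_subset subset_rfl)
    · rw [Finset.card_union_of_disjoint ((hM b).disjoint hN hdisj)]
      have := hMc b
      nlinarith
    · exact (hin b).trans (Set.ncard_le_ncard (Set.inter_subset_inter_left _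
        (Set.prod_mono (hsub b) subset_rfl)))
    · exact (hout b).trans (Set.ncard_le_ncard (Set.sdiff_subset_sdiff_left
        (Set.prod_mono (hsub b) subset_rfl)))

/-! ### Degrees -/

theorem ncard_neighborSet_boxProd_le (h b : ℕ) (x : TernaryVertex h × Fin b) :
    (((ternaryTree h).boxProd (SimpleGraph.pathGraph b)).neighborSet x).ncard ≤ 6 := by
  classical
  -- Three children, the parent and two path neighbours. At the root and at path position 0,
  -- `dropLast` and truncated subtraction return `x` itself, which only enlarges the candidate set.
  let C : Finset (List (Fin 3) × ℕ) :=
    {(x.1.1 ++ [0], x.2.1), (x.1.1 ++ [1], x.2.1), (x.1.1 ++ [2], x.2.1),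
      (x.1.1.dropLast, x.2.1), (x.1.1, x.2.1 + 1), (x.1.1, x.2.1 - 1)}
  have h1 : (((ternaryTree h).boxProd (SimpleGraph.pathGraph b)).neighborSet x).ncard ≤
      (C : Set (List (Fin 3) × ℕ)).ncard := by
    refine Set.ncard_le_ncard_of_injOn (fun y => (y.1.1, y.2.1)) ?_ ?_ (Set.toFinite _)
    · rintro ⟨u, i⟩ hy
      rw [SimpleGraph.mem_neighborSet, SimpleGraph.boxProd_adj, ternaryTree_adj,
        SimpleGraph.pathGraph_adj] at hy
      simp only [C, Finset.coe_insert, Finset.coe_singleton, Set.mem_insert_iff,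
        Set.mem_singleton_iff, Prod.mk.injEq]
      rcases hy with ⟨⟨e, he⟩ | ⟨e, he⟩, hi⟩ | ⟨hi | hi, hu⟩
      · rw [he, hi]
        fin_cases e <;> simp
      · rw [he, hi]
        simp
      · rw [hu, ← hi]
        simp
      · rw [hu, ← hi]
        simp
    · rintro ⟨u, i⟩ _ ⟨v, j⟩ _ huv
      simp only [Prod.mk.injEq] at huv
      exact Prod.ext (Subtype.ext huv.1) (Fin.ext huv.2)
  rw [Set.ncard_coe_finset] at h1
  exact h1.trans Finset.card_le_six

/-! ### Treewidth -/

theorem primalGraph_cnfOfGraph {V : Type*} (G : SimpleGraph V) :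
    primalGraph (cnfOfGraph G) = G := by
  ext u v
  constructor
  · rintro ⟨hne, C, ⟨x, y, hxy, rfl⟩, ⟨b, hb⟩, ⟨b', hb'⟩⟩
    simp only [Set.mem_insert_iff, Set.mem_singleton_iff, Prod.mk.injEq] at hb hb'
    rcases hb with ⟨rfl, -⟩ | ⟨rfl, -⟩ <;> rcases hb' with ⟨rfl, -⟩ | ⟨rfl, -⟩
    exacts [absurd rfl hne, hxy, hxy.symm, absurd rfl hne]
  · intro huv
    exact ⟨huv.ne, _, ⟨u, v, huv, rfl⟩, ⟨true, by simp⟩, ⟨true, by simp⟩⟩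

/-- The bag at `t` holds the copies over `t` and its parent, on the tree itself; at the root,
`dropLast` makes the two coincide. A vertex over `t` then occurs exactly at `t` and its children. -/
theorem treewidth_boxProd_le (h b w : ℕ) (B : SimpleGraph (Fin b)) (hw : 2 * b ≤ w) :
    treewidth ((ternaryTree h).boxProd B) ≤ w := by
  classical
  let bag : TernaryVertex h → Finset (TernaryVertex h × Fin b) := fun t =>
    {t, ⟨t.1.dropLast, (by have := t.2; rw [List.length_dropLast]; omega)⟩} ×ˢ Finset.univ
  have hbag : ∀ t x, x ∈ bag t ↔ x.1 = t ∨ x.1.1 = t.1.dropLast := by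
    intro t x
    simp [bag, Subtype.ext_iff]
  have D : ∃ D : TreeDecomposition ((ternaryTree h).boxProd B), ∀ i, (D.bag i).card ≤ w + 1 := by
    refine ⟨⟨TernaryVertex h, inferInstance, ternaryTree h, ternaryTree_isTree h, bag, ?_, ?_, ?_⟩,
      ?_⟩
    · exact fun v => ⟨v.1, (hbag _ _).2 (Or.inl rfl)⟩
    · intro u v huv
      rw [SimpleGraph.boxProd_adj, ternaryTree_adj] at huv
      simp only [hbag]
      rcases huv with ⟨⟨e, he⟩ | ⟨e, he⟩, -⟩ | ⟨-, huv⟩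
      · exact ⟨v.1, Or.inr (by simp [he]), Or.inl rfl⟩
      · exact ⟨u.1, Or.inl rfl, Or.inr (by simp [he])⟩
      · exact ⟨v.1, Or.inl huv, Or.inl rfl⟩
    · intro v
      refine ternaryTree_induce_preconnected v.1 ((hbag _ _).2 (Or.inl rfl)) ?_
      intro t ht hne
      rcases (hbag _ _).1 ht with h1 | h1
      · exact absurd h1.symm hne
      · have hnil : t.1 ≠ [] := by
          intro h0
          refine hne (Subtype.ext ?_)
          rw [h1, h0, List.dropLast_nil]
        refine ⟨v.1, (hbag _ _).2 (Or.inl rfl), t.1.getLast hnil, ?_⟩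
        rw [h1, List.dropLast_append_getLast hnil]
    · intro t
      have h2 : (bag t).card ≤ 2 * b := by
        rw [Finset.card_product, Finset.card_univ, Fintype.card_fin]
        exact Nat.mul_le_mul_right _ Finset.card_le_two
      exact h2.trans (by omega)
  exact iInf₂_le w D

/-! ### Read-once branching programs -/

theorem LabelledDAG.Path.append {V : Type*} {Z : LabelledDAG V} {u v w : Z.Node}
    {L L' : List (Literal V)} (h : Z.Path u v L) (h' : Z.Path v w L') : Z.Path u w (L ++ L') := by
  induction h with
  | nil u => exact h'
  | cons he _ ih =>
    rw [List.append_assoc]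
    exact LabelledDAG.Path.cons he (ih h')

/-- The index `j` counts literals rather than edges, since unlabelled edges add nothing to the list.
-/
theorem LabelledDAG.Path.exists_split {V : Type*} {Z : LabelledDAG V} {u w : Z.Node}
    {L : List (Literal V)} (h : Z.Path u w L) (j : ℕ) :
    ∃ v, Z.Path u v (L.take j) ∧ Z.Path v w (L.drop j) := by
  induction h generalizing j with
  | nil u => exact ⟨u, by simpa using LabelledDAG.Path.nil u, by simpa using LabelledDAG.Path.nil u⟩
  | @cons u v w l L he hp ih =>
    cases l with
    | none =>
      obtain ⟨x, h1, h2⟩ := ih j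
      exact ⟨x, LabelledDAG.Path.cons he h1, h2⟩
    | some l =>
      cases j with
      | zero => exact ⟨u, LabelledDAG.Path.nil u, LabelledDAG.Path.cons he hp⟩
      | succ j =>
        obtain ⟨x, h1, h2⟩ := ih j
        exact ⟨x, LabelledDAG.Path.cons he h1, h2⟩

namespace NROBP

variable {V : Type*} (Z : NROBP V)

/-- The variables occurring on the paths from the source to the node `z`. -/
def readBefore (z : Z.Node) : Set V :=
  {x | ∃ L, Z.toLabelledDAG.Path Z.source z L ∧ x ∈ L.map Prod.fst}

/-- The assignments accepted along a path through the node `z`. -/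
def acceptedVia (z : Z.Node) : Set (V → Bool) :=
  {a | ∃ L L', Z.toLabelledDAG.Path Z.source z L ∧ Z.toLabelledDAG.Path z Z.sink L' ∧
    (∀ l ∈ L, Sat a l) ∧ ∀ l ∈ L', Sat a l}

variable {Z} {z : Z.Node} {L L' : List (Literal V)}

theorem not_mem_readBefore (h' : Z.toLabelledDAG.Path z Z.sink L') {x : V}
    (hx : x ∈ L'.map Prod.fst) : x ∉ Z.readBefore z := by
  rintro ⟨L₁, h₁, hx₁⟩
  have := Z.nodup _ (h₁.append h')
  rw [List.map_append] at this
  exact List.disjoint_of_nodup_append this hx₁ hx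

/-- All source-`z` paths read the same variables, namely those missing from any fixed continuation
to the sink. -/
theorem mem_readBefore_iff (h : Z.toLabelledDAG.Path Z.source z L)
    (h' : Z.toLabelledDAG.Path z Z.sink L') {x : V} :
    x ∈ Z.readBefore z ↔ x ∈ L.map Prod.fst := by
  refine ⟨fun hx => ?_, fun hx => ⟨L, h, hx⟩⟩
  have := Z.occurs _ (h.append h') x
  rw [List.map_append, List.mem_append] at this
  exact this.resolve_right fun h₂ => not_mem_readBefore h' h₂ hx

/-- If the program only accepts models of `φ(G)`, then each edge of `G` between a variable read
before the node `z` and a variable read after it has an end that is true in all assignments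
accepted via `z`. -/
theorem forced_of_adj {G : SimpleGraph V} (hZ : Z.toFun ⊆ (cnfOfGraph G).models) {x y : V}
    (hxy : G.Adj x y) (hx : x ∈ Z.readBefore z) (hy : y ∉ Z.readBefore z) :
    (∀ a ∈ Z.acceptedVia z, a x = true) ∨ ∀ a ∈ Z.acceptedVia z, a y = true := by
  classical
  by_contra! hcon
  obtain ⟨⟨a, ⟨La, La', ha, ha', hsa, -⟩, hax⟩, b, ⟨Lb, Lb', -, hb', -, hsb'⟩, hby⟩ := hcon
  -- The splice of `a` before `z` and `b` after it is accepted, yet falsifies the clause of the edge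
  -- `xy`.
  let c : V → Bool := fun v => if v ∈ Z.readBefore z then a v else b v
  have hc : c ∈ Z.toFun := by
    refine ⟨La ++ Lb', ha.append hb', fun l hl => ?_⟩
    rcases List.mem_append.1 hl with hl | hl
    · have : l.1 ∈ Z.readBefore z := ⟨La, ha, List.mem_map_of_mem hl⟩
      have h2 := hsa l hl
      simpa [Sat, c, this] using h2
    · have : l.1 ∉ Z.readBefore z := not_mem_readBefore hb' (List.mem_map_of_mem hl)
      have h2 := hsb' l hl
      simpa [Sat, c, this] using h2
  rcases mem_models_cnfOfGraph.1 (hZ hc) x y hxy with h | h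
  · exact hax (by simpa [c, hx] using h)
  · exact hby (by simpa [c, hy] using h)

/-- Choose a forced end of each edge. Choices from different edges differ: first ends are read
before `z`, second ends are not, and each kind is injective on `M`. -/
theorem exists_forced_of_crossingMatching {G : SimpleGraph V}
    (hZ : Z.toFun ⊆ (cnfOfGraph G).models) {U : Set V} {M : Finset (V × V)}
    (hM : IsCrossingMatching G (Z.readBefore z) U M) :
    ∃ D : Finset V, D.card = M.card ∧ (D : Set V) ⊆ U ∧
      ∀ a ∈ Z.acceptedVia z, ∀ x ∈ D, a x = true := by
  classical
  let f : V × V → V := fun e => if ∀ a ∈ Z.acceptedVia z, a e.1 = true then e.1 else e.2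
  have hf : ∀ e, f e = e.1 ∨ f e = e.2 := fun e => by
    by_cases h : ∀ a ∈ Z.acceptedVia z, a e.1 = true
    exacts [Or.inl (if_pos h), Or.inr (if_neg h)]
  refine ⟨M.image f, Finset.card_image_of_injOn ?_, ?_, ?_⟩
  · intro e he e' he' hee'
    rcases hf e with h | h <;> rcases hf e' with h' | h' <;> rw [h, h'] at hee'
    · exact hM.fst_inj he he' hee'
    · exact absurd (hee' ▸ (hM.fst_mem e he).1) (hM.snd_mem e' he').1
    · exact absurd (hee'.symm ▸ (hM.fst_mem e' he').1) (hM.snd_mem e he).1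
    · exact hM.snd_inj he he' hee'
  · intro x hx
    obtain ⟨e, he, rfl⟩ := Finset.mem_image.1 (Finset.mem_coe.1 hx)
    rcases hf e with h | h <;> rw [h]
    exacts [(hM.fst_mem e he).2, (hM.snd_mem e he).2]
  · intro a ha x hx
    obtain ⟨e, he, rfl⟩ := Finset.mem_image.1 hx
    by_cases h : ∀ a ∈ Z.acceptedVia z, a e.1 = true
    · simp only [f, if_pos h]
      exact h a ha
    · have := (forced_of_adj hZ (hM.adj e he) (hM.fst_mem e he).1
        (hM.snd_mem e he).1).resolve_left h
      simp only [f, if_neg h]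
      exact this a ha

/-- Each initial segment of the order in which the variables occur along an accepting path is the
set of the variables read before some node of the path. -/
theorem exists_order_of_mem_toFun {a : V → Bool} (ha : a ∈ Z.toFun) :
    ∃ ρ : V → ℕ, Function.Injective ρ ∧
      ∀ j, ∃ z, a ∈ Z.acceptedVia z ∧ Z.readBefore z = {x | ρ x < j} := by
  classical
  obtain ⟨L, hL, hs⟩ := ha
  refine ⟨fun x => (L.map Prod.fst).idxOf x, fun x y hxy =>
    (List.idxOf_inj (Z.occurs L hL x)).1 hxy, fun j => ?_⟩
  obtain ⟨z, h1, h2⟩ := hL.exists_split j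
  refine ⟨z, ⟨_, _, h1, h2, fun l hl => hs l (List.mem_of_mem_take hl),
    fun l hl => hs l (List.mem_of_mem_drop hl)⟩, ?_⟩
  ext x
  rw [mem_readBefore_iff h1 h2, List.map_take, List.mem_take_iff_idxOf_lt (Z.occurs L hL x)]
  rfl

/-- If, for each ordering of the vertices, each of the disjoint sets `U i` contains a matching of
size `t` crossing some initial segment, then a small program accepts few models of `φ(G)`. -/
theorem ncard_toFun_le [Finite V] {G : SimpleGraph V} (hZ : Z.toFun ⊆ (cnfOfGraph G).models)
    {d : ℕ} (hd : ∀ v, (G.neighborSet v).ncard ≤ d) {I : Type*} [Fintype I] {U : I → Set V}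
    (hU : Pairwise fun i j => Disjoint (U i) (U j)) {t : ℕ}
    (ht : ∀ ρ : V → ℕ, Function.Injective ρ → ∀ i, ∃ j M,
      IsCrossingMatching G {x | ρ x < j} (U i) M ∧ t ≤ M.card) :
    (2 ^ d + 1) ^ (Fintype.card I * t) * Z.toFun.ncard ≤
      Z.size ^ Fintype.card I * ((2 ^ d) ^ (Fintype.card I * t) * (cnfOfGraph G).models.ncard) := by
  classical
  have := Z.finite_node
  have := Fintype.ofFinite Z.Node
  -- A witness `D` serves all assignments accepted via `z`, so it can be chosen from the node and
  -- `i` alone; the union bound then runs over node tuples only.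
  let P : Z.Node → I → Finset V → Prop := fun z i D =>
    D.card = t ∧ (D : Set V) ⊆ U i ∧ ∀ a ∈ Z.acceptedVia z, ∀ x ∈ D, a x = true
  let A : (I → Z.Node) → Set (V → Bool) := fun f =>
    {a | a ∈ Z.toFun ∧ ∀ i, (∃ D, P (f i) i D) ∧ a ∈ Z.acceptedVia (f i)}
  have hcover : Z.toFun ⊆ ⋃ f, A f := by
    intro a ha
    obtain ⟨ρ, hρ, hnode⟩ := exists_order_of_mem_toFun ha
    have : ∀ i, ∃ z, (∃ D, P z i D) ∧ a ∈ Z.acceptedVia z := by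
      intro i
      obtain ⟨j, M, hM, hMt⟩ := ht ρ hρ i
      obtain ⟨z, hz, hrb⟩ := hnode j
      rw [← hrb] at hM
      obtain ⟨D, hDc, hDU, hDf⟩ := exists_forced_of_crossingMatching hZ hM
      obtain ⟨D', hD', hD'c⟩ := Finset.exists_subset_card_eq (hMt.trans hDc.ge)
      exact ⟨z, ⟨D', hD'c, (Finset.coe_subset.2 hD').trans hDU,
        fun b hb x hx => hDf b hb x (hD' hx)⟩, hz⟩
    choose f hf using this
    exact Set.mem_iUnion.2 ⟨f, ha, hf⟩
  have hA : ∀ f, (2 ^ d + 1) ^ (Fintype.card I * t) * (A f).ncard ≤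
      (2 ^ d) ^ (Fintype.card I * t) * (cnfOfGraph G).models.ncard := by
    intro f
    by_cases hf : ∀ i, ∃ D, P (f i) i D
    · choose D hDc hDU hDf using hf
      have hcard : (Finset.univ.biUnion D).card = Fintype.card I * t := by
        rw [Finset.card_biUnion]
        · simp [hDc, Finset.card_univ]
        · intro i _ j _ hij
          exact Finset.disjoint_coe.1 ((hU hij).mono (hDU i) (hDU j))
      rw [← hcard]
      refine le_trans (Nat.mul_le_mul_left _ (Set.ncard_le_ncard ?_))
        (card_models_forced G d hd (Finset.univ.biUnion D))
      intro a ha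
      refine ⟨hZ ha.1, fun x hx => ?_⟩
      obtain ⟨i, -, hxi⟩ := Finset.mem_biUnion.1 hx
      exact hDf i a (ha.2 i).2 x hxi
    · have : A f = ∅ := by
        refine Set.eq_empty_of_forall_notMem fun a ha => hf fun i => (ha.2 i).1
      simp [this]
  have hsum : Z.toFun.ncard ≤ ∑ f, (A f).ncard :=
    (Set.ncard_le_ncard hcover).trans (Set.ncard_iUnion_le_of_fintype A)
  calc (2 ^ d + 1) ^ (Fintype.card I * t) * Z.toFun.ncard
      ≤ (2 ^ d + 1) ^ (Fintype.card I * t) * ∑ f, (A f).ncard := Nat.mul_le_mul_left _ hsum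
    _ = ∑ f, (2 ^ d + 1) ^ (Fintype.card I * t) * (A f).ncard := Finset.mul_sum _ _ _
    _ ≤ ∑ _f : I → Z.Node, (2 ^ d) ^ (Fintype.card I * t) * (cnfOfGraph G).models.ncard :=
        Finset.sum_le_sum fun f _ => hA f
    _ = _ := by
        rw [Finset.sum_const, Finset.card_univ, Fintype.card_fun, smul_eq_mul, size,
          Nat.card_eq_fintype_card]

end NROBP

/-- The bound of `NROBP.ncard_toFun_le` for the graphs `T(P)`. -/
theorem ncard_toFun_le_boxProd {h p h₀ s m : ℕ} (hp : 0 < p) (hph : p ≤ 3 ^ h₀)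
    (hh : m + (h₀ + s) = h) (Z : NROBP (TernaryVertex h × Fin (2 * p)))
    (hZ : Z.toFun ⊆
      (cnfOfGraph ((ternaryTree h).boxProd (SimpleGraph.pathGraph (2 * p)))).models) :
    65 ^ (3 ^ m * (p * (s + 1))) * Z.toFun.ncard ≤
      Z.size ^ 3 ^ m * (64 ^ (3 ^ m * (p * (s + 1))) *
        (cnfOfGraph ((ternaryTree h).boxProd (SimpleGraph.pathGraph (2 * p)))).models.ncard) := by
  -- The words of length `m` index the `3 ^ m` disjoint subtrees at depth `m`.
  have := NROBP.ncard_toFun_le hZ (d := 6) (ncard_neighborSet_boxProd_le h (2 * p))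
    (I := Fin m → Fin 3)
    (U := fun f => subtree h (List.ofFn f) ×ˢ (Set.univ : Set (Fin (2 * p)))) (by
      intro f g hfg
      refine Set.disjoint_left.2 fun x hx hx' => ?_
      exact Set.disjoint_left.1 (disjoint_subtree (by simp)
        fun h => hfg (List.ofFn_injective h)) hx.1 hx'.1) (t := p * (s + 1)) (by
      intro ρ hρ f
      obtain ⟨j, M, hM, hMc, -⟩ := exists_initial_crossingMatching hp hph hρ s (List.ofFn f)
        (by simpa using hh)
      exact ⟨j, M, hM, hMc⟩)
  simpa using this

/-! ### Numerical estimates -/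

/-- The counting gain is at least `2 ^ (M * t / 64)`. Half of this exponent pays for `2 ^ √n`, and
the other half survives the `M`-th root. -/
theorem two_rpow_le_of_counting {s M t A B : ℕ} {n : ℝ} (hM : 0 < M) (hB : 0 < B)
    (hcount : 65 ^ (M * t) * B ≤ s ^ M * (64 ^ (M * t) * A))
    (hdens : (A : ℝ) / B ≤ 2 ^ √n) (hn : √n ≤ M * t / 128) : (2 : ℝ) ^ ((t : ℝ) / 128) ≤ s := by
  have hB' : (0 : ℝ) < B := by exact_mod_cast hB
  have h64 : (0 : ℝ) < 64 ^ (M * t) := by positivity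
  have hA : (A : ℝ) ≤ 2 ^ √n * B := (div_le_iff₀ hB').1 hdens
  have h1 : (65 : ℝ) ^ (M * t) * B ≤ s ^ M * (64 ^ (M * t) * A) := by exact_mod_cast hcount
  have h2 : ((65 : ℝ) / 64) ^ (M * t) ≤ s ^ M * 2 ^ √n := by
    rw [div_pow, div_le_iff₀ h64]
    refine le_of_mul_le_mul_right (h1.trans ?_) hB'
    calc (s : ℝ) ^ M * (64 ^ (M * t) * A) ≤ s ^ M * (64 ^ (M * t) * (2 ^ √n * B)) := by gcongr
      _ = _ := by ring
  have h3 : (2 : ℝ) ^ ((1 : ℝ) / 64) ≤ 65 / 64 := by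
    have h4 : (2 : ℝ) ≤ (65 / 64) ^ (64 : ℕ) := by norm_num
    calc (2 : ℝ) ^ ((1 : ℝ) / 64) ≤ ((65 / 64 : ℝ) ^ (64 : ℕ)) ^ ((1 : ℝ) / 64) := by gcongr
      _ = 65 / 64 := by
        rw [← Real.rpow_natCast, ← Real.rpow_mul (by norm_num)]
        norm_num
  have h5 : (2 : ℝ) ^ ((M : ℝ) * t / 64) ≤ (65 / 64) ^ (M * t) := by
    calc (2 : ℝ) ^ ((M : ℝ) * t / 64) = ((2 : ℝ) ^ ((1 : ℝ) / 64)) ^ (M * t) := by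
          rw [← Real.rpow_natCast, ← Real.rpow_mul (by norm_num)]
          congr 1
          push_cast
          ring
      _ ≤ _ := by gcongr
  have h6 : (2 : ℝ) ^ √n ≤ 2 ^ ((M : ℝ) * t / 128) :=
    Real.rpow_le_rpow_of_exponent_le (by norm_num) hn
  have h7 : (2 : ℝ) ^ ((M : ℝ) * t / 128) * 2 ^ ((M : ℝ) * t / 128) ≤
      s ^ M * 2 ^ ((M : ℝ) * t / 128) := by
    rw [← Real.rpow_add (by norm_num)]
    calc (2 : ℝ) ^ ((M : ℝ) * t / 128 + (M : ℝ) * t / 128) = 2 ^ ((M : ℝ) * t / 64) := by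
          congr 1
          ring
      _ ≤ s ^ M * 2 ^ √n := h5.trans h2
      _ ≤ _ := by gcongr
  have h8 : ((2 : ℝ) ^ ((t : ℝ) / 128)) ^ M ≤ (s : ℝ) ^ M := by
    have := le_of_mul_le_mul_right h7 (by positivity)
    calc ((2 : ℝ) ^ ((t : ℝ) / 128)) ^ M = 2 ^ ((M : ℝ) * t / 128) := by
          rw [← Real.rpow_natCast, ← Real.rpow_mul (by norm_num)]
          congr 1
          ring
      _ ≤ _ := this
  exact le_of_pow_le_pow_left₀ hM.ne' (by positivity) h8

/-- Many vertices relative to `k` mean a tall tree: the `clog 3 q` levels spent on the base case are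
about a ninth of the height. The bound 9 comes from `3 ^ 8 < 16384`. -/
theorem clog_three_bounds {q h : ℕ} (hq : 16384 ≤ q) (hqh : q ^ 10 ≤ q * 3 ^ (h + 1)) :
    9 ≤ Nat.clog 3 q ∧ 9 * Nat.clog 3 q ≤ h + 10 := by
  have h9 : 9 ≤ Nat.clog 3 q := by
    by_contra! hlt
    have h1 := Nat.le_pow_clog (b := 3) (by norm_num) q
    have h2 : 3 ^ Nat.clog 3 q ≤ 3 ^ 8 := Nat.pow_le_pow_right (by norm_num) (by omega)
    norm_num at h2
    omega
  refine ⟨h9, ?_⟩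
  have h1 : 3 ^ (Nat.clog 3 q - 1) ≤ q :=
    (Nat.pow_pred_clog_lt_self (b := 3) (by norm_num) (by omega)).le
  have h2 : q ^ 9 ≤ 3 ^ (h + 1) := by
    refine Nat.le_of_mul_le_mul_left ?_ (by omega : 0 < q)
    calc q * q ^ 9 = q ^ 10 := by ring
      _ ≤ _ := hqh
  have h3 : 3 ^ ((Nat.clog 3 q - 1) * 9) ≤ 3 ^ (h + 1) := by
    rw [pow_mul]
    exact (Nat.pow_le_pow_left h1 9).trans h2
  have := (Nat.pow_le_pow_iff_right (by norm_num : 1 < 3)).1 h3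
  omega

/-- The threshold is `16384 = 128 ^ 2`: one factor `p` of `t ^ 2 ≥ p ^ 2` covers it. -/
theorem sqrt_le_of_le_pow {n p h m t : ℕ} (hp : 16384 ≤ p) (hn : n ≤ p * 3 ^ (h + 1))
    (hm : h + 1 ≤ 2 * m) (ht : p ≤ t) : √(n : ℝ) ≤ ((3 ^ m : ℕ) : ℝ) * t / 128 := by
  rw [Real.sqrt_le_left (by positivity)]
  have h1 : (n : ℝ) ≤ p * 3 ^ (h + 1) := by exact_mod_cast hn
  have h2 : (3 : ℝ) ^ (h + 1) ≤ 3 ^ (2 * m) := pow_le_pow_right₀ (by norm_num) hm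
  have h3 : (16384 : ℝ) ≤ p := by exact_mod_cast hp
  have h4 : (p : ℝ) ≤ t := by exact_mod_cast ht
  calc (n : ℝ) ≤ p * 3 ^ (2 * m) := h1.trans (by gcongr)
    _ = 16384 * p * 3 ^ (2 * m) / 16384 := by ring
    _ ≤ p * p * 3 ^ (2 * m) / 16384 := by gcongr
    _ ≤ t * t * 3 ^ (2 * m) / 16384 := by gcongr
    _ = _ := by
      push_cast
      ring

theorem rpow_le_two_rpow {n k p h h₀ t : ℕ} (hn : n ≤ p * 3 ^ (h + 1)) (hp : p ≤ 3 ^ h₀)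
    (hh : 2 * (h₀ + h + 1) ≤ 3 * h) (hk : k ≤ 8 * p) (ht : p * h ≤ 4 * t) :
    (n : ℝ) ^ ((k : ℝ) / 12288) ≤ 2 ^ ((t : ℝ) / 128) := by
  have h1 : n ≤ 2 ^ (3 * h) := by
    calc n ≤ 3 ^ h₀ * 3 ^ (h + 1) := hn.trans (Nat.mul_le_mul_right _ hp)
      _ = 3 ^ (h₀ + h + 1) := by ring
      _ ≤ 4 ^ (h₀ + h + 1) := Nat.pow_le_pow_left (by norm_num) _
      _ = 2 ^ (2 * (h₀ + h + 1)) := by rw [pow_mul]; norm_num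
      _ ≤ _ := Nat.pow_le_pow_right (by norm_num) hh
  have h2 : (n : ℝ) ≤ 2 ^ (3 * h) := by exact_mod_cast h1
  have h3 : (h : ℝ) * k ≤ h * (8 * p) := by
    gcongr
    exact_mod_cast hk
  have h4 : (p : ℝ) * h ≤ 4 * t := by exact_mod_cast ht
  calc (n : ℝ) ^ ((k : ℝ) / 12288) ≤ ((2 : ℝ) ^ (3 * h)) ^ ((k : ℝ) / 12288) := by gcongr
    _ = 2 ^ (3 * (h : ℝ) * (k / 12288)) := by
      rw [← Real.rpow_natCast, ← Real.rpow_mul (by norm_num)]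
      push_cast
      rfl
    _ ≤ _ := by
      refine Real.rpow_le_rpow_of_exponent_le (by norm_num) ?_
      linarith

/-- The lower bound on the size for one of the graphs `T(P)`. -/
theorem rpow_le_size {k p h : ℕ} (hk : 65536 ≤ k) (hp : p = k / 4)
    (hcard : k ^ 10 ≤ Nat.card (TernaryVertex h × Fin (2 * p)))
    (Z : NROBP (TernaryVertex h × Fin (2 * p))) (hne : Z.toFun.Nonempty)
    (hZ : Z.toFun ⊆
      (cnfOfGraph ((ternaryTree h).boxProd (SimpleGraph.pathGraph (2 * p)))).models)
    (hdens : (Nat.card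
        (cnfOfGraph ((ternaryTree h).boxProd (SimpleGraph.pathGraph (2 * p)))).models : ℝ) /
      (Nat.card Z.toFun : ℝ) ≤ 2 ^ √(Nat.card (TernaryVertex h × Fin (2 * p)) : ℝ)) :
    (Nat.card (TernaryVertex h × Fin (2 * p)) : ℝ) ^ ((k : ℝ) / 12288) ≤ Z.size := by
  have hpk : 16384 ≤ p := by omega
  have hn : Nat.card (TernaryVertex h × Fin (2 * p)) ≤ p * 3 ^ (h + 1) := by
    have := card_ternaryVertex_le h
    rw [Nat.card_prod, Nat.card_fin]
    nlinarith
  obtain ⟨h9, hh₀⟩ := clog_three_bounds hpk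
    ((Nat.pow_le_pow_left (by omega : p ≤ k) 10).trans (hcard.trans hn))
  have hp₀ := Nat.le_pow_clog (b := 3) (by norm_num) p
  -- Rounded so that `h + 1 ≤ 2 * m`, which makes `3 ^ m` large enough against `√n`; at least about
  -- `h / 4` levels still remain for `s`.
  obtain ⟨m, hm⟩ : ∃ m, m = (h + 2) / 2 := ⟨_, rfl⟩
  obtain ⟨s, hs⟩ : ∃ s, s = h - m - Nat.clog 3 p := ⟨_, rfl⟩
  have ht : p * h ≤ 4 * (p * (s + 1)) := by
    have : h ≤ 4 * (s + 1) := by omega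
    nlinarith
  have hcount := ncard_toFun_le_boxProd (m := m) (s := s) (by omega) hp₀ (by omega) Z hZ
  rw [Nat.card_coe_set_eq, Nat.card_coe_set_eq] at hdens
  refine (rpow_le_two_rpow hn hp₀ (by omega) (by omega) ht).trans
    (two_rpow_le_of_counting (by positivity) ((Set.ncard_pos (Set.toFinite _)).2 hne) hcount hdens
      (sqrt_le_of_le_pow hpk hn (by omega) (Nat.le_mul_of_pos_right _ (by omega))))

theorem le_card_ternaryVertex (h : ℕ) : h ≤ Nat.card (TernaryVertex h) := by
  have h1 : 3 ^ h ≤ (subtree h []).ncard := pow_le_ncard_subtree (by simp)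
  have h2 : (subtree h []).ncard ≤ Nat.card (TernaryVertex h) := by
    rw [← Set.ncard_univ]
    exact Set.ncard_le_ncard (Set.subset_univ _)
  exact (Nat.lt_pow_self (by norm_num)).le.trans (h1.trans h2)

end ReadOnceBound

theorem theorem4p1 :
    ∃ c : ℝ, 0 < c ∧ ∃ m k₀ : ℕ, ∀ k : ℕ, k₀ ≤ k →
      (∀ N : ℕ, ∃ φ ∈ ReadOnceBound.cnfClass m k, N ≤ Nat.card φ.1) ∧
      ∀ φ ∈ ReadOnceBound.cnfClass m k,
        ReadOnceBound.treewidth (ReadOnceBound.primalGraph φ.2) ≤ (k : ℕ∞) ∧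
        ∀ F : ReadOnceBound.BoolFun φ.1, F.Nonempty → F ⊆ φ.2.models →
          (Nat.card φ.2.models : ℝ) / (Nat.card F : ℝ) ≤ (2 : ℝ) ^ Real.sqrt (Nat.card φ.1) →
          ∀ Z : ReadOnceBound.NROBP φ.1, Z.toFun = F →
            (Nat.card φ.1 : ℝ) ^ ((k : ℝ) / c) ≤ (Z.size : ℝ) := by
  -- `12288 = 3 * 8 * 4 * 128`, from `n ≤ 2 ^ (3 * h)`, `k ≤ 8 * p`, `p * h ≤ 4 * t` and the size
  -- bound `2 ^ (t / 128)`; `65536 = 4 * 16384` makes `k / 4` at least 16384.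
  refine ⟨12288, by norm_num, 10, 65536, fun k hk => ⟨fun N => ?_, ?_⟩⟩
  · have hcard : k ^ 10 + N ≤
        Nat.card (ReadOnceBound.TernaryVertex (k ^ 10 + N) × Fin (2 * (k / 4))) := by
      rw [Nat.card_prod, Nat.card_fin]
      exact (ReadOnceBound.le_card_ternaryVertex _).trans (Nat.le_mul_of_pos_right _ (by omega))
    exact ⟨_, ⟨_, ⟨k ^ 10 + N, rfl⟩, (Nat.le_add_right _ _).trans hcard, rfl⟩,
      (Nat.le_add_left _ _).trans hcard⟩
  · rintro _ ⟨_, ⟨h, rfl⟩, hcard, rfl⟩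
    refine ⟨?_, ?_⟩
    · rw [ReadOnceBound.primalGraph_cnfOfGraph]
      exact ReadOnceBound.treewidth_boxProd_le h _ k _ (by omega)
    · rintro _ hne hsub hdens Z rfl
      exact ReadOnceBound.rpow_le_size hk rfl hcard Z hne hsub hdens
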